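/- Let $A=\mathbb{C}[x_1,\dots,x_n]$, and let $GL_n(\mathbb{C})$ act on $A$ by $(g.f)(x)=f(g^{-1}x)$. A binomial is a polynomial $x^a-\lambda x^b$ with $a,b\in\mathbb{Z}_{\ge 0}^n$, $\lambda\in\mathbb{C}$ (so monomials are included); it is unital if $\lambda\in\{0,1\}$. An ideal is toric if it is prime and can be generated by unital binomials. Let $I\subset A$ be a homogeneous prime ideal, let $G\subset GL_n(\mathbb{C})$ be the group of all $g$ with $g.I=I$, let $T$ be a maximal torus of $G$ (maximal among the algebraic tori contained in $G$), and let $\mathfrak{t}=\{X\in M_n(\mathbb{C}) : \exp(zX)\in T \text{ for all } z\in\mathbb{C}\}$ be its Lie algebra. Assume that the affine variety $\mathcal{V}(I)\subset\mathbb{C}^n$ is not contained in any hyperplane $a_1x_1+\dots+a_nx_n=0$ with $a\ne 0$. 1. If $\dim\mathcal{V}(I)=\dim T$, then $I$ is toric after a linear change of coordinates: there is $S\in GL_n(\mathbb{C})$ such that $S.I$ is toric. 2. The check whether $I$ becomes binomial in coordinates that diagonalize $\mathfrak{t}$ can be replaced by a comparison of dimensions: for every $S\in GL_n(\mathbb{C})$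 such that $S\mathfrak{t}S^{-1}$ consists of diagonal matrices, $S.I$ can be generated by binomials if and only if $\dim\mathcal{V}(I)=\dim T$. -/

import Mathlib

open MvPolynomial Matrix

attribute [local instance] MvPolynomial.gradedAlgebra

noncomputable section

/-- The action of `GL_n(ℂ)` on `ℂ[x_1, …, x_n]` given by `(g.f)(x) = f(g⁻¹ x)`. -/
def linAct {n : ℕ} (g : GL (Fin n) ℂ) :
    MvPolynomial (Fin n) ℂ →ₐ[ℂ] MvPolynomial (Fin n) ℂ :=
  aeval fun i => ∑ j, C ((g⁻¹ : GL (Fin n) ℂ).val i j) * X j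

theorem eval_linAct {n : ℕ} (g : GL (Fin n) ℂ) (f : MvPolynomial (Fin n) ℂ) (x : Fin n → ℂ) :
    eval x (linAct g f) = eval ((g⁻¹ : GL (Fin n) ℂ).val *ᵥ x) f := by
  induction f using MvPolynomial.induction_on with
  | C a => simp [linAct]
  | add p q hp hq => simp [hp, hq]
  | mul_X p i hp =>
    rw [map_mul, map_mul, map_mul, hp]
    simp [linAct, Matrix.mulVec, dotProduct]

theorem linAct_one {n : ℕ} : linAct (1 : GL (Fin n) ℂ) = AlgHom.id ℂ _ := by
  refine AlgHom.ext fun f => ?_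
  refine MvPolynomial.funext fun x => ?_
  simp [eval_linAct]

theorem linAct_mul {n : ℕ} (g h : GL (Fin n) ℂ) :
    linAct (g * h) = (linAct g).comp (linAct h) := by
  refine AlgHom.ext fun f => ?_
  refine MvPolynomial.funext fun x => ?_
  simp only [AlgHom.comp_apply, eval_linAct, _root_.mul_inv_rev, Units.val_mul, Matrix.mulVec_mulVec]

/-- The ideal `g.I` obtained from `I` by the linear change of coordinates `g`.  Since `f ↦ g.f`
is a ring automorphism, the ideal generated by the image of `I` is the image itself. -/
def coordChange {n : ℕ} (g : GL (Fin n) ℂ) (I : Ideal (MvPolynomial (Fin n) ℂ)) :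
    Ideal (MvPolynomial (Fin n) ℂ) :=
  I.map (linAct g)

theorem coordChange_one {n : ℕ} (I : Ideal (MvPolynomial (Fin n) ℂ)) :
    coordChange 1 I = I := by
  rw [coordChange, linAct_one]
  exact Ideal.map_id I

theorem coordChange_mul {n : ℕ} (g h : GL (Fin n) ℂ) (I : Ideal (MvPolynomial (Fin n) ℂ)) :
    coordChange (g * h) I = coordChange g (coordChange h I) := by
  rw [coordChange, coordChange, coordChange, linAct_mul]
  exact (Ideal.map_map (I := I) (linAct h).toRingHom (linAct g).toRingHom).symm

/-- The group `G ⊆ GL_n(ℂ)` that fixes the ideal `I`.  A subgroup `H` satisfies `h.I ⊆ I` for all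
`h ∈ H` if and only if `H ≤ fixingGroup I`, so this is the largest such group. -/
def fixingGroup {n : ℕ} (I : Ideal (MvPolynomial (Fin n) ℂ)) : Subgroup (GL (Fin n) ℂ) where
  carrier := {g | coordChange g I = I}
  mul_mem' {g h} hg hh := by
    rw [Set.mem_ofPred_eq] at hg hh ⊢
    rw [coordChange_mul, hh, hg]
  one_mem' := coordChange_one I
  inv_mem' {g} hg := by
    rw [Set.mem_ofPred_eq] at hg ⊢
    conv_lhs => rw [← hg]
    rw [← coordChange_mul, inv_mul_cancel, coordChange_one]

/-- A regular function on `(ℂ^*)^k` is one given by a Laurent polynomial. -/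
def IsRegularOnTorus {k : ℕ} (f : (Fin k → ℂˣ) → ℂ) : Prop :=
  ∃ p : (Fin k → ℤ) →₀ ℂ, ∀ t, f t = p.sum fun a c => c * ((∏ i, t i ^ a i : ℂˣ) : ℂ)

/-- `T ⊆ GL_n(ℂ)` is an algebraic torus of dimension `k`: the image of an injective homomorphism
of algebraic groups `(ℂ^*)^k → GL_n(ℂ)`.  (In characteristic zero such an image is closed, and
the homomorphism is an isomorphism of algebraic groups onto it.) -/
def IsTorusOfDim {n : ℕ} (T : Subgroup (GL (Fin n) ℂ)) (k : ℕ) : Prop :=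
  ∃ φ : (Fin k → ℂˣ) →* GL (Fin n) ℂ, Function.Injective φ ∧
    (∀ i j, IsRegularOnTorus fun t => (φ t).val i j) ∧ φ.range = T

/-- `T` is a maximal torus of `G`. -/
def IsMaximalTorus {n : ℕ} (G T : Subgroup (GL (Fin n) ℂ)) : Prop :=
  Maximal (fun H : Subgroup (GL (Fin n) ℂ) => H ≤ G ∧ ∃ k, IsTorusOfDim H k) T

/-- The (complex) Lie algebra of a closed subgroup `H ⊆ GL_n(ℂ)`: all `X` with `exp(zX) ∈ H` for
all `z ∈ ℂ`. -/
def lieAlgebraOf {n : ℕ} (H : Subgroup (GL (Fin n) ℂ)) : Set (Matrix (Fin n) (Fin n) ℂ) :=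
  {X | ∀ z : ℂ, ∃ h ∈ H, h.val = NormedSpace.exp (z • X)}

/-- The change of coordinates `S` diagonalizes the set of matrices `A`. -/
def Diagonalizes {n : ℕ} (S : GL (Fin n) ℂ) (A : Set (Matrix (Fin n) (Fin n) ℂ)) : Prop :=
  ∀ X ∈ A, (S.val * X * (S⁻¹ : GL (Fin n) ℂ).val).IsDiag

/-- The dimension of an affine variety: the Krull dimension of its coordinate ring. -/
def varietyDim {n : ℕ} (V : Set (Fin n → ℂ)) : WithBot ℕ∞ :=
  ringKrullDim (MvPolynomial (Fin n) ℂ ⧸ vanishingIdeal ℂ V)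

/-- `V` is not contained in any hyperplane `a_1 x_1 + … + a_n x_n = 0`, `a ≠ 0`.  (For a cone `V`
containing the origin, hyperplanes that miss the origin do not matter.) -/
def IsNondegenerate {n : ℕ} (V : Set (Fin n → ℂ)) : Prop :=
  ∀ a : Fin n → ℂ, a ≠ 0 → ¬ V ⊆ {x | ∑ i, a i * x i = 0}

/-- A binomial `x^a - c x^b`; monomials (`c = 0`) are included. -/
def IsBinomial {n : ℕ} (f : MvPolynomial (Fin n) ℂ) : Prop :=
  ∃ (a b : Fin n →₀ ℕ) (c : ℂ), f = monomial a 1 - monomial b c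

/-- A unital binomial: `x^a - c x^b` with `c = 0` or `c = 1`. -/
def IsUnitalBinomial {n : ℕ} (f : MvPolynomial (Fin n) ℂ) : Prop :=
  ∃ (a b : Fin n →₀ ℕ) (c : ℂ), (c = 0 ∨ c = 1) ∧ f = monomial a 1 - monomial b c

/-- An ideal that can be generated by binomials. -/
def IsBinomialIdeal {n : ℕ} (J : Ideal (MvPolynomial (Fin n) ℂ)) : Prop :=
  ∃ B : Set (MvPolynomial (Fin n) ℂ), (∀ f ∈ B, IsBinomial f) ∧ J = Ideal.span B

/-- A toric ideal: prime and generated by unital binomials. -/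
def IsToricIdeal {n : ℕ} (J : Ideal (MvPolynomial (Fin n) ℂ)) : Prop :=
  J.IsPrime ∧
    ∃ B : Set (MvPolynomial (Fin n) ℂ), (∀ f ∈ B, IsUnitalBinomial f) ∧ J = Ideal.span B

end

/-! Choose coordinates `S` in which T is diagonal, with weights a_i in ℤ^k. Nondegeneracy keeps
every variable out of S.I; since S.I is prime, it is determined by the points p of its variety with
all coordinates nonzero. The orbit of such a p is parametrized by x_i = p_i t^{a_i}. Its ideal, the
kernel of `toricMap a p`, contains S.I, is generated by the binomials x^u - p^{u-v} x^v with u, v of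
equal weight (`ker_toricMap_eq_span`), and has a quotient of dimension k because T acts faithfully
(`ringKrullDim_quotient_ker_toricMap`).

If dim V(I) = k, these two nested primes coincide (`coordChange_eq_ker_toricMap`), so S.I is
binomial. Rescaling p to (1, …, 1) turns all coefficients into 1, which gives a toric ideal.

Conversely, let S.I be binomial. Its torus points form a coset of the group cut out by the lattice
of Laurent monomials that are constant on them. Primality makes this lattice saturated
(`constLattice_saturated`), so the group is a torus (`exists_subtorus`). It preserves S.I and
contains the conjugate of T, hence equals it by maximality. So T is transitive on the torus points,
S.I is the ideal of one orbit, and the dimension is k. -/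

noncomputable section

/-! ### Characters and diagonalization of torus representations -/

/-- The character `t ↦ t_1^{a_1} ⋯ t_k^{a_k}` of the torus `(ℂ^*)^k`, with values in `ℂ`. -/
def torusChar {k : ℕ} (a : Fin k → ℤ) : (Fin k → ℂˣ) →* ℂ :=
  (Units.coeHom ℂ).comp
    { toFun := fun t => ∏ i, t i ^ a i
      map_one' := by simp
      map_mul' := fun s t => by simp [mul_zpow, Finset.prod_mul_distrib] }

theorem torusChar_apply {k : ℕ} (a : Fin k → ℤ) (t : Fin k → ℂˣ) :
    torusChar a t = ((∏ i, t i ^ a i : ℂˣ) : ℂ) := rfl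

theorem torusChar_ne_zero {k : ℕ} (a : Fin k → ℤ) (t : Fin k → ℂˣ) : torusChar a t ≠ 0 :=
  Units.ne_zero _

theorem torusChar_zero {k : ℕ} (t : Fin k → ℂˣ) : torusChar 0 t = 1 := by
  simp [torusChar_apply]

theorem torusChar_add {k : ℕ} (a b : Fin k → ℤ) (t : Fin k → ℂˣ) :
    torusChar (a + b) t = torusChar a t * torusChar b t := by
  simp only [torusChar_apply, Pi.add_apply, _root_.zpow_add, Finset.prod_mul_distrib, Units.val_mul]

theorem torusChar_injective {k : ℕ} :
    Function.Injective (torusChar : (Fin k → ℤ) → (Fin k → ℂˣ) →* ℂ) := by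
  intro a b h
  funext i
  -- Evaluate at the point with ith coordinate 2 and the others 1; 2 is not a root of unity, so its
  -- powers determine the exponent.
  have h2 := DFunLike.congr_fun h (Pi.mulSingle i (Units.mk0 (2 : ℂ) two_ne_zero))
  simp only [torusChar_apply] at h2
  rw [Finset.prod_eq_single i, Finset.prod_eq_single i] at h2
  · simp only [Pi.mulSingle_eq_same, Units.val_zpow_eq_zpow_val, Units.val_mk0] at h2
    have h3 : ((2 : ℝ) ^ a i) = (2 : ℝ) ^ b i := by
      have := congrArg (fun z : ℂ => ‖z‖) h2
      simpa using this
    exact zpow_right_injective₀ (by norm_num) (by norm_num) h3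
  all_goals simp +contextual [Pi.mulSingle_eq_of_ne]

theorem linearIndependent_torusChar {k : ℕ} :
    LinearIndependent ℂ (fun a : Fin k → ℤ => (torusChar a : (Fin k → ℂˣ) → ℂ)) :=
  (linearIndependent_monoidHom (Fin k → ℂˣ) ℂ).comp torusChar torusChar_injective

/-- A character of the torus that is a regular function is a Laurent monomial. -/
theorem exists_eq_torusChar {k : ℕ} (d : (Fin k → ℂˣ) →* ℂ) (hd : IsRegularOnTorus d) :
    ∃ a, d = torusChar a := by
  obtain ⟨p, hp⟩ := hd
  -- Otherwise `d` would be a character in the span of characters distinct from it, against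
  -- Dedekind's independence of characters.
  by_contra! h
  refine (linearIndependent_monoidHom (Fin k → ℂˣ) ℂ).notMem_span_image
    (s := Set.range torusChar) (x := d) ?_ ?_
  · rintro ⟨a, ha⟩
    exact h a ha.symm
  · have : (d : (Fin k → ℂˣ) → ℂ) = ∑ a ∈ p.support, p a • (torusChar a : (Fin k → ℂˣ) → ℂ) := by
      funext t
      rw [hp t, Finsupp.sum, Finset.sum_apply]
      rfl
    rw [this]
    refine Submodule.sum_mem _ fun a _ => Submodule.smul_mem _ _ (Submodule.subset_span ?_)
    exact ⟨torusChar a, ⟨a, rfl⟩, rfl⟩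

theorem isRegularOnTorus_sum_torusChar {k : ℕ} {ι : Type*} (s : Finset ι) (c : ι → ℂ)
    (a : ι → Fin k → ℤ) : IsRegularOnTorus fun t => ∑ l ∈ s, c l * torusChar (a l) t := by
  classical
  refine ⟨∑ l ∈ s, Finsupp.single (a l) (c l), fun t => ?_⟩
  rw [← Finsupp.sum_finsetSum_index (fun _ => by simp) (fun _ _ _ => by ring)]
  refine Finset.sum_congr rfl fun l _ => ?_
  rw [Finsupp.sum_single_index (by simp)]
  rfl

theorem IsRegularOnTorus.linearCombination {k : ℕ} {ι : Type*} (s : Finset ι) (c : ι → ℂ)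
    (f : ι → (Fin k → ℂˣ) → ℂ) (hf : ∀ i, IsRegularOnTorus (f i)) :
    IsRegularOnTorus fun t => ∑ l ∈ s, c l * f l t := by
  choose p hp using hf
  have := isRegularOnTorus_sum_torusChar (s.sigma fun l => (p l).support)
    (fun x => c x.1 * p x.1 x.2) (fun x => x.2)
  convert this using 2 with t
  rw [Finset.sum_sigma]
  refine Finset.sum_congr rfl fun l _ => ?_
  rw [hp, Finsupp.sum, Finset.mul_sum]
  exact Finset.sum_congr rfl fun a _ => by rw [torusChar_apply]; ring

/-- Conjugating a matrix-valued regular function gives a regular function. -/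
theorem isRegularOnTorus_mul_mul {k n : ℕ} (φ : (Fin k → ℂˣ) → Matrix (Fin n) (Fin n) ℂ)
    (hφ : ∀ i j, IsRegularOnTorus fun t => φ t i j) (P Q : Matrix (Fin n) (Fin n) ℂ) (i j : Fin n) :
    IsRegularOnTorus fun t => (P * φ t * Q) i j := by
  have := IsRegularOnTorus.linearCombination Finset.univ
    (fun x : Fin n × Fin n => P i x.1 * Q x.2 j) (fun x t => φ t x.1 x.2) (fun x => hφ x.1 x.2)
  convert this using 2 with t
  rw [Fintype.sum_prod_type_right, Matrix.mul_apply]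
  refine Finset.sum_congr rfl fun l _ => ?_
  rw [Matrix.mul_apply, Finset.sum_mul]
  exact Finset.sum_congr rfl fun m _ => by ring

/-- The weight vectors of a regular representation of a torus span. -/
theorem span_weightVectors_eq_top {k n : ℕ} (φ : (Fin k → ℂˣ) →* GL (Fin n) ℂ)
    (hφ : ∀ i j, IsRegularOnTorus fun t => (φ t).val i j) :
    Submodule.span ℂ {v : Fin n → ℂ | ∃ a, ∀ t, (φ t).val *ᵥ v = torusChar a t • v} = ⊤ := by
  classical
  choose p hp using hφ
  let F : Finset (Fin k → ℤ) := Finset.univ.biUnion fun x : Fin n × Fin n => (p x.1 x.2).support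
  let M : (Fin k → ℤ) → Matrix (Fin n) (Fin n) ℂ := fun a => Matrix.of fun i j => p i j a
  have hF : ∀ t, (φ t).val = ∑ a ∈ F, torusChar a t • M a := by
    intro t
    ext i j
    refine (hp i j t).trans ?_
    rw [Matrix.sum_apply]
    rw [Finsupp.sum_of_support_subset (s := F)]
    · exact Finset.sum_congr rfl fun a _ => mul_comm _ _
    · intro a ha
      exact Finset.mem_biUnion.2 ⟨(i, j), Finset.mem_univ _, ha⟩
    · simp
  -- Comparing the coefficients of each character of s in φ(t)φ(s) = φ(ts) shows that the image of
  -- M_a consists of vectors of weight a.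
  have hM : ∀ t, ∀ a ∈ F, (φ t).val * M a = torusChar a t • M a := by
    intro t
    have key : ∀ i j, ∀ a ∈ F, ((φ t).val * M a - torusChar a t • M a) i j = 0 := by
      intro i j
      refine linearIndependent_iff'.1 linearIndependent_torusChar F
        (fun a => ((φ t).val * M a - torusChar a t • M a) i j) ?_
      funext s
      have h1 : (φ t).val * (φ s).val = (φ (t * s)).val := by simp
      rw [hF s, hF (t * s), Finset.mul_sum] at h1
      have h2 := congrFun (congrFun h1 i) j
      rw [Matrix.sum_apply, Matrix.sum_apply, ← sub_eq_zero, ← Finset.sum_sub_distrib] at h2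
      rw [Finset.sum_apply]
      refine Eq.trans (Finset.sum_congr rfl fun a _ => ?_) h2
      simp only [Pi.smul_apply, smul_eq_mul, Matrix.sub_apply, Matrix.smul_apply, Matrix.mul_smul,
        map_mul]
      ring
    intro a ha
    ext i j
    exact sub_eq_zero.1 (key i j a ha)
  rw [eq_top_iff]
  rintro v -
  -- Since φ(1) = 1, the matrices M_a sum to the identity and split every vector into weight
  -- vectors.
  have hv : v = ∑ a ∈ F, M a *ᵥ v := by
    have h1 := hF 1
    simp only [map_one, Units.val_one, one_smul] at h1
    rw [← Matrix.sum_mulVec, ← h1, Matrix.one_mulVec]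
  rw [hv]
  refine Submodule.sum_mem _ fun a ha => Submodule.subset_span ⟨a, fun t => ?_⟩
  rw [Matrix.mulVec_mulVec, hM t a ha, Matrix.smul_mulVec]

/-- A regular representation of a torus is diagonalizable. -/
theorem exists_diagonal_torusChar {k n : ℕ} (φ : (Fin k → ℂˣ) →* GL (Fin n) ℂ)
    (hφ : ∀ i j, IsRegularOnTorus fun t => (φ t).val i j) :
    ∃ (S : GL (Fin n) ℂ) (a : Fin n → Fin k → ℤ), ∀ t,
      S.val * (φ t).val * (S⁻¹ : GL (Fin n) ℂ).val = diagonal fun i => torusChar (a i) t := by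
  set W : Set (Fin n → ℂ) := {v | ∃ a, ∀ t, (φ t).val *ᵥ v = torusChar a t • v} with hW
  have hspan : ⊤ ≤ Submodule.span ℂ W := (span_weightVectors_eq_top φ hφ).ge
  let b0 := Module.Basis.ofSpan hspan
  have hb0 : ∀ i, b0 i ∈ W := fun i => Module.Basis.ofSpan_subset hspan ⟨i, rfl⟩
  have := b0.indexEquiv (Pi.basisFun ℂ (Fin n))
  let b := b0.reindex this
  have hb : ∀ i, b i ∈ W := fun i => by simpa [b] using hb0 _
  choose a ha using hb
  let Q : Matrix (Fin n) (Fin n) ℂ := (Pi.basisFun ℂ (Fin n)).toMatrix b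
  let R : Matrix (Fin n) (Fin n) ℂ := b.toMatrix (Pi.basisFun ℂ (Fin n))
  refine ⟨⟨R, Q, Module.Basis.toMatrix_mul_toMatrix_flip _ _,
    Module.Basis.toMatrix_mul_toMatrix_flip _ _⟩, a, fun t => ?_⟩
  have hQ : (φ t).val * Q = Q * diagonal fun i => torusChar (a i) t := by
    ext i j
    have := congrFun (ha j t) i
    rw [Matrix.mul_diagonal]
    simp only [Pi.smul_apply, smul_eq_mul, Matrix.mulVec, dotProduct] at this
    rw [Matrix.mul_apply]
    simpa [Q, Module.Basis.toMatrix_apply, mul_comm] using this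
  change R * (φ t).val * Q = _
  rw [Matrix.mul_assoc, hQ, ← Matrix.mul_assoc, Module.Basis.toMatrix_mul_toMatrix_flip,
    Matrix.one_mul]

/-- If `S` diagonalizes the Lie algebra of a torus, it diagonalizes the torus. -/
theorem Diagonalizes.isDiag_conj {k n : ℕ} {S : GL (Fin n) ℂ} {T : Subgroup (GL (Fin n) ℂ)}
    (hS : Diagonalizes S (lieAlgebraOf T)) (φ : (Fin k → ℂˣ) →* GL (Fin n) ℂ)
    (hφ : ∀ i j, IsRegularOnTorus fun t => (φ t).val i j) (hT : φ.range ≤ T) (t : Fin k → ℂˣ) :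
    (S.val * (φ t).val * (S⁻¹ : GL (Fin n) ℂ).val).IsDiag := by
  obtain ⟨P, a, hP⟩ := exists_diagonal_torusChar φ hφ
  have hφP : ∀ t, (φ t).val = (P⁻¹ : GL (Fin n) ℂ).val *
      (diagonal fun i => torusChar (a i) t) * P.val := by
    intro t
    rw [← hP t]
    simp only [← Units.val_mul]
    congr 1
    group
  have hu : ∀ i, ∃ u : ℂ, Complex.exp u = t i := fun i => by
    refine ⟨Complex.log (t i), Complex.exp_log (t i).ne_zero⟩
  choose u hu using hu
  -- A logarithm of φ(t): all its complex multiples exponentiate into the torus, so it lies in the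
  -- Lie algebra and `S` diagonalizes it, hence also its exponential φ(t).
  let X : Matrix (Fin n) (Fin n) ℂ :=
    (P⁻¹ : GL (Fin n) ℂ).val * (diagonal fun i => ∑ j, a i j * u j) * P.val
  have hexp : ∀ z : ℂ, ∀ s : Fin k → ℂˣ, (∀ j, (s j : ℂ) = Complex.exp (z * u j)) →
      (φ s).val = NormedSpace.exp (z • X) := by
    intro z s hs
    have hX : z • X = (P⁻¹ : GL (Fin n) ℂ).val *
        (diagonal fun i => z * ∑ j, a i j * u j) * P.val := by
      simp only [X]
      rw [← Matrix.smul_mul, ← Matrix.mul_smul, ← Matrix.diagonal_smul]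
      rfl
    rw [hX, Matrix.exp_units_conj' P, Matrix.exp_diagonal, hφP]
    congr 3
    funext i
    rw [Pi.coe_exp, ← Complex.exp_eq_exp_ℂ, torusChar_apply, Finset.mul_sum, Complex.exp_sum,
      Units.coe_prod]
    refine Finset.prod_congr rfl fun j _ => ?_
    rw [Units.val_zpow_eq_zpow_val, hs, ← Complex.exp_int_mul]
    congr 1
    ring
  have hX : X ∈ lieAlgebraOf T := fun z =>
    ⟨φ fun j => Units.mk0 (Complex.exp (z * u j)) (Complex.exp_ne_zero _), hT ⟨_, rfl⟩,
      hexp z _ fun _ => rfl⟩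
  rw [hexp 1 t fun j => by rw [one_mul, hu], one_smul, ← Matrix.exp_units_conj S,
    ← (hS X hX).diagonal_diag, Matrix.exp_diagonal]
  exact Matrix.isDiag_diagonal _

/-- If `S` diagonalizes a regular representation of a torus, the diagonal entries are Laurent
monomials. -/
theorem exists_eq_diagonal_torusChar {k n : ℕ} (S : GL (Fin n) ℂ)
    (φ : (Fin k → ℂˣ) →* GL (Fin n) ℂ) (hφ : ∀ i j, IsRegularOnTorus fun t => (φ t).val i j)
    (hS : ∀ t, (S.val * (φ t).val * (S⁻¹ : GL (Fin n) ℂ).val).IsDiag) :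
    ∃ a : Fin n → Fin k → ℤ, ∀ t,
      S.val * (φ t).val * (S⁻¹ : GL (Fin n) ℂ).val = diagonal fun i => torusChar (a i) t := by
  have hmul : ∀ s t, S.val * (φ (s * t)).val * (S⁻¹ : GL (Fin n) ℂ).val =
      (S.val * (φ s).val * (S⁻¹ : GL (Fin n) ℂ).val) *
        (S.val * (φ t).val * (S⁻¹ : GL (Fin n) ℂ).val) := by
    intro s t
    simp only [← Units.val_mul, map_mul]
    congr 1
    group
  let d : Fin n → (Fin k → ℂˣ) →* ℂ := fun i =>
    { toFun := fun t => (S.val * (φ t).val * (S⁻¹ : GL (Fin n) ℂ).val) i i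
      map_one' := by
        rw [map_one, Units.val_one, Matrix.mul_one, ← Units.val_mul, mul_inv_cancel, Units.val_one,
          Matrix.one_apply_eq]
      map_mul' := fun s t => by
        rw [hmul, ← (hS s).diagonal_diag, ← (hS t).diagonal_diag, Matrix.diagonal_mul_diagonal]
        simp }
  have hd : ∀ i, ∃ a, d i = torusChar a := fun i =>
    exists_eq_torusChar (d i) (isRegularOnTorus_mul_mul (fun t => (φ t).val) hφ _ _ i i)
  choose a ha using hd
  refine ⟨a, fun t => ?_⟩
  rw [← (hS t).diagonal_diag]
  congr 1
  funext i
  exact DFunLike.congr_fun (ha i) t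

/-! ### Monomial parametrizations and their kernels -/

/-- The monomial parametrization `x_i ↦ p_i t^{a_i}`, as a homomorphism to the ring of Laurent
polynomials in `k` variables. -/
def toricMap {n k : ℕ} (a : Fin n → Fin k → ℤ) (p : Fin n → ℂ) :
    MvPolynomial (Fin n) ℂ →ₐ[ℂ] AddMonoidAlgebra ℂ (Fin k → ℤ) :=
  aeval fun i => AddMonoidAlgebra.single (a i) (p i)

theorem toricMap_monomial {n k : ℕ} (a : Fin n → Fin k → ℤ) (p : Fin n → ℂ) (u : Fin n →₀ ℕ)
    (c : ℂ) : toricMap a p (monomial u c) =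
      AddMonoidAlgebra.single (∑ i, u i • a i) (c * ∏ i, p i ^ u i) := by
  rw [toricMap, aeval_monomial, Finsupp.prod_fintype _ _ (fun i => pow_zero _)]
  have : ∀ s : Finset (Fin n), ∏ i ∈ s, AddMonoidAlgebra.single (a i) (p i) ^ u i =
      AddMonoidAlgebra.single (∑ i ∈ s, u i • a i) (∏ i ∈ s, p i ^ u i) := by
    intro s
    induction s using Finset.cons_induction with
    | empty => rfl
    | cons i s hi ih =>
      rw [Finset.prod_cons, ih, Finset.sum_cons, Finset.prod_cons, AddMonoidAlgebra.single_pow,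
        AddMonoidAlgebra.single_mul_single]
  rw [this, AddMonoidAlgebra.coe_algebraMap, Function.comp_apply,
    AddMonoidAlgebra.single_mul_single, zero_add]
  rfl

/-- Evaluation of a Laurent polynomial at a point of the torus. -/
def laurentEval {k : ℕ} (t : Fin k → ℂˣ) : AddMonoidAlgebra ℂ (Fin k → ℤ) →ₐ[ℂ] ℂ :=
  AddMonoidAlgebra.lift ℂ ℂ (Fin k → ℤ)
    { toFun := fun a => torusChar a.toAdd t
      map_one' := torusChar_zero t
      map_mul' := fun a b => torusChar_add a.toAdd b.toAdd t }

theorem laurentEval_single {k : ℕ} (t : Fin k → ℂˣ) (a : Fin k → ℤ) (c : ℂ) :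
    laurentEval t (AddMonoidAlgebra.single a c) = c * torusChar a t := by
  rw [laurentEval, AddMonoidAlgebra.lift_single]
  rfl

/-- This is the independence of characters again; it lets membership in the kernel of `toricMap` be
tested pointwise on an orbit. -/
theorem eq_zero_of_laurentEval {k : ℕ} (f : AddMonoidAlgebra ℂ (Fin k → ℤ))
    (hf : ∀ t, laurentEval t f = 0) : f = 0 := by
  refine AddMonoidAlgebra.coeff_eq_zero.1 (linearIndependent_iff.1 linearIndependent_torusChar _ ?_)
  funext t
  rw [Pi.zero_apply, ← hf t, Finsupp.linearCombination_apply, Finsupp.sum, laurentEval,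
    AddMonoidAlgebra.lift_apply, Finsupp.sum, Finset.sum_apply]
  rfl

theorem laurentEval_toricMap {n k : ℕ} (a : Fin n → Fin k → ℤ) (p : Fin n → ℂ) (t : Fin k → ℂˣ)
    (f : MvPolynomial (Fin n) ℂ) :
    laurentEval t (toricMap a p f) = eval (fun i => p i * torusChar (a i) t) f := by
  have : (laurentEval t).comp (toricMap a p) = aeval fun i => p i * torusChar (a i) t := by
    ext i
    simp [toricMap, laurentEval_single]
  rw [← AlgHom.comp_apply, this, aeval_eq_eval]

theorem mem_ker_toricMap {n k : ℕ} {a : Fin n → Fin k → ℤ} {p : Fin n → ℂ}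
    {f : MvPolynomial (Fin n) ℂ} :
    f ∈ RingHom.ker (toricMap a p) ↔ ∀ t, eval (fun i => p i * torusChar (a i) t) f = 0 := by
  rw [RingHom.mem_ker]
  refine ⟨fun h t => by rw [← laurentEval_toricMap, h, map_zero], fun h => ?_⟩
  exact eq_zero_of_laurentEval _ fun t => by rw [laurentEval_toricMap, h]

/-- The binomials `x^u - p^{u-v} x^v` for which `u` and `v` have the same weight. -/
def toricBinomials {n k : ℕ} (a : Fin n → Fin k → ℤ) (p : Fin n → ℂ) :
    Set (MvPolynomial (Fin n) ℂ) :=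
  {f | ∃ u v : Fin n →₀ ℕ, ∑ i, u i • a i = ∑ i, v i • a i ∧
    f = monomial u 1 - monomial v ((∏ i, p i ^ u i) / ∏ i, p i ^ v i)}

/-- Modulo the binomials, a monomial depends only on its weight, up to a known scalar. The quotient
map therefore factors linearly through `toricMap`, so it kills the kernel. -/
theorem ker_toricMap_eq_span {n k : ℕ} (a : Fin n → Fin k → ℤ) (p : Fin n → ℂ)
    (hp : ∀ i, p i ≠ 0) :
    RingHom.ker (toricMap a p) = Ideal.span (toricBinomials a p) := by
  have hpu : ∀ u : Fin n →₀ ℕ, ∏ i, p i ^ u i ≠ 0 := fun u =>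
    Finset.prod_ne_zero_iff.2 fun i _ => pow_ne_zero _ (hp i)
  refine le_antisymm ?_ (Ideal.span_le.2 ?_)
  · classical
    -- A chosen exponent vector for each weight; the default 0 for weights that do not occur plays
    -- no role.
    let r : (Fin k → ℤ) → Fin n →₀ ℕ := fun w =>
      if h : ∃ u : Fin n →₀ ℕ, ∑ i, u i • a i = w then h.choose else 0
    have hr : ∀ u : Fin n →₀ ℕ,
        ∑ i, r (∑ i, u i • a i) i • a i = ∑ i, u i • a i := fun u => by
      have h : ∃ v : Fin n →₀ ℕ, ∑ i, v i • a i = ∑ i, u i • a i := ⟨u, rfl⟩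
      simp only [r, dif_pos h]
      exact h.choose_spec
    let J := Ideal.span (toricBinomials a p)
    let ρ : AddMonoidAlgebra ℂ (Fin k → ℤ) →ₗ[ℂ] MvPolynomial (Fin n) ℂ ⧸ J :=
      (Finsupp.linearCombination ℂ fun w =>
        (∏ i, p i ^ r w i)⁻¹ • Ideal.Quotient.mk J (monomial (r w) 1)) ∘ₗ
        (AddMonoidAlgebra.coeffLinearEquiv ℂ).toLinearMap
    have hρ : ρ ∘ₗ (toricMap a p).toLinearMap = (Ideal.Quotient.mkₐ ℂ J).toLinearMap := by
      refine MvPolynomial.linearMap_ext fun u => LinearMap.ext_ring ?_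
      change ρ (toricMap a p (monomial u 1)) = Ideal.Quotient.mk J (monomial u 1)
      rw [toricMap_monomial]
      change Finsupp.linearCombination ℂ _ (Finsupp.single _ _) = _
      rw [Finsupp.linearCombination_single, one_mul, smul_smul]
      have := Ideal.Quotient.eq.2 (Ideal.subset_span ⟨u, r (∑ i, u i • a i), (hr u).symm, rfl⟩ :
        monomial u 1 - monomial (r (∑ i, u i • a i)) ((∏ i, p i ^ u i) /
          ∏ i, p i ^ r (∑ i, u i • a i) i) ∈ J)
      rw [this, ← div_eq_mul_inv]
      change _ = Ideal.Quotient.mkₐ ℂ J _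
      conv_rhs => rw [← mul_one (_ / _), ← smul_eq_mul, ← smul_monomial, map_smul]
      rfl
    intro f hf
    refine Ideal.Quotient.eq_zero_iff_mem.1 ?_
    have := LinearMap.congr_fun hρ f
    refine this.symm.trans ?_
    change ρ (toricMap a p f) = 0
    rw [(RingHom.mem_ker).1 hf, map_zero]
  · rintro _ ⟨u, v, huv, rfl⟩
    rw [SetLike.mem_coe, RingHom.mem_ker, map_sub, toricMap_monomial, toricMap_monomial, huv,
      one_mul, div_mul_cancel₀ _ (hpu v), sub_self]

theorem isBinomialIdeal_ker_toricMap {n k : ℕ} (a : Fin n → Fin k → ℤ) (p : Fin n → ℂ)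
    (hp : ∀ i, p i ≠ 0) : IsBinomialIdeal (RingHom.ker (toricMap a p)) :=
  ⟨toricBinomials a p, fun _ ⟨u, v, _, h⟩ => ⟨u, v, _, h⟩, ker_toricMap_eq_span a p hp⟩

theorem isPrime_ker_toricMap {n k : ℕ} (a : Fin n → Fin k → ℤ) (p : Fin n → ℂ) :
    (RingHom.ker (toricMap a p)).IsPrime :=
  RingHom.ker_isPrime _

theorem isToricIdeal_ker_toricMap_one {n k : ℕ} (a : Fin n → Fin k → ℤ) :
    IsToricIdeal (RingHom.ker (toricMap a 1)) := by
  refine ⟨isPrime_ker_toricMap a 1, _, ?_, ker_toricMap_eq_span a 1 fun _ => one_ne_zero⟩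
  rintro _ ⟨u, v, _, rfl⟩
  exact ⟨u, v, _, Or.inr (by simp), rfl⟩

/-- Independent weights allow u and v of equal weight only when u = v, so every generating binomial
of the kernel is zero. -/
theorem toricMap_injective {n k : ℕ} {a : Fin n → Fin k → ℤ} (ha : LinearIndependent ℤ a)
    {p : Fin n → ℂ} (hp : ∀ i, p i ≠ 0) : Function.Injective (toricMap a p) := by
  rw [injective_iff_map_eq_zero]
  intro f hf
  have hf' : f ∈ Ideal.span (toricBinomials a p) := ker_toricMap_eq_span a p hp ▸ hf
  have : toricBinomials a p ⊆ {0} := by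
    rintro _ ⟨u, v, huv, rfl⟩
    have : u = v := by
      ext i
      have h := Fintype.linearIndependent_iff.1 ha (fun i => (u i : ℤ) - v i)
        (by
        simp only [sub_smul, Finset.sum_sub_distrib, natCast_zsmul, huv, sub_self]) i
      omega
    subst this
    rw [div_self (Finset.prod_ne_zero_iff.2 fun i _ => pow_ne_zero _ (hp i))]
    simp
  simpa using Ideal.span_mono this hf'

/-! ### Krull dimension and transcendence degree -/

/-- Integral extensions preserve the Krull dimension. -/
theorem ringKrullDim_eq_of_isIntegral (R S : Type*) [CommRing R] [CommRing S] [Algebra R S]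
    [Algebra.IsIntegral R S] [FaithfulSMul R S] : ringKrullDim S = ringKrullDim R := by
  refine le_antisymm ?_ ?_
  -- Incomparability: contraction of primes is strictly monotone along an integral extension.
  · refine Order.krullDim_le_of_strictMono (PrimeSpectrum.comap (algebraMap R S)) fun P Q h => ?_
    exact Ideal.IsIntegral.comap_lt_comap (R := R) (I := P.asIdeal) (J := Q.asIdeal) h
  -- Conversely, lying over lifts the bottom prime of a chain, and going up lifts the rest.
  · have : Algebra.HasGoingUp R S := ⟨fun {q} hq P hP hlt => by
      obtain ⟨Q, hPQ, hQ, h⟩ := Ideal.exists_ideal_over_prime_of_isIntegral q P hlt.le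
      exact ⟨Q, hPQ, hQ, ⟨h.symm⟩⟩⟩
    refine iSup_le fun l => ?_
    obtain ⟨P, -, hP, h⟩ := Ideal.exists_ideal_over_prime_of_isIntegral (S := S) l.head.asIdeal ⊥ <| by
      rw [← RingHom.ker_eq_comap_bot,
        (RingHom.injective_iff_ker_eq_bot _).1 (FaithfulSMul.algebraMap_injective R S)]
      exact bot_le
    have : P.LiesOver l.head.asIdeal := ⟨h.symm⟩
    obtain ⟨L, hL, -⟩ := Ideal.exists_ltSeries_of_hasGoingUp l P
    rw [← hL]
    exact Order.LTSeries.length_le_krullDim L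

/-- The Krull dimension of a finitely generated domain over a field is the cardinality of any
finite transcendence basis. -/
theorem ringKrullDim_eq_of_isTranscendenceBasis {F R : Type} [Field F] [CommRing R] [IsDomain R]
    [Algebra F R] [Algebra.FiniteType F R] {k : ℕ} {x : Fin k → R}
    (hx : IsTranscendenceBasis F x) : ringKrullDim R = k := by
  obtain ⟨s, g, hg, hint⟩ := exists_integral_inj_algHom_of_fg F R
  algebraize [g.toRingHom]
  have : IsScalarTower F (MvPolynomial (Fin s) F) R := .of_algebraMap_eq fun r => (g.commutes r).symm
  have : FaithfulSMul (MvPolynomial (Fin s) F) R := (faithfulSMul_iff_algebraMap_injective _ _).2 hg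
  have : Algebra.IsIntegral (MvPolynomial (Fin s) F) R := ⟨hint⟩
  -- The variables of a Noether normalization are also a transcendence basis, so their number is k.
  have hy := (IsTranscendenceBasis.mvPolynomial (Fin s) F).algebraMap_comp (A := R)
  have hsk := hy.cardinalMk_eq_trdeg.trans hx.cardinalMk_eq_trdeg.symm
  rw [ringKrullDim_eq_of_isIntegral (MvPolynomial (Fin s) F) R,
    MvPolynomial.ringKrullDim_of_isNoetherianRing, ringKrullDim_eq_zero_of_field, zero_add]
  simp only [Cardinal.mk_fin, Nat.cast_inj] at hsk
  simp [hsk]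

theorem trdeg_laurent_le (k : ℕ) : Algebra.trdeg ℂ (AddMonoidAlgebra ℂ (Fin k → ℤ)) ≤ k := by
  classical
  let x : Fin k → AddMonoidAlgebra ℂ (Fin k → ℤ) := fun i => AddMonoidAlgebra.single (Pi.single i 1) 1
  let A := Algebra.adjoin ℂ (Set.range x)
  have hmem : ∀ (u : Fin k →₀ ℕ) (c : ℂ), AddMonoidAlgebra.single (fun i => (u i : ℤ)) c ∈ A := by
    intro u c
    have h1 : toricMap (fun i : Fin k => Pi.single i (1 : ℤ)) 1 (monomial u c) ∈ A := by
      rw [show A = (aeval x).range from Algebra.adjoin_range_eq_range_aeval _ _]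
      exact ⟨_, rfl⟩
    rw [toricMap_monomial] at h1
    convert h1 using 2
    · funext j
      simp [Finset.sum_apply, Pi.single_apply]
    · simp
  have halg : Algebra.IsAlgebraic A (AddMonoidAlgebra ℂ (Fin k → ℤ)) := by
    refine ⟨fun f => ?_⟩
    induction f using AddMonoidAlgebra.induction_linear with
    | zero => exact isAlgebraic_zero
    | add f g hf hg => exact hf.add hg
    | single w c =>
      let u : Fin k →₀ ℕ := Finsupp.equivFunOnFinite.symm fun i => (w i).toNat
      let v : Fin k →₀ ℕ := Finsupp.equivFunOnFinite.symm fun i => (-w i).toNat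
      -- With w = u - v split into positive and negative parts, c x^w is a root of x^v Y - c x^u.
      refine ⟨Polynomial.C ⟨_, hmem v 1⟩ * Polynomial.X - Polynomial.C ⟨_, hmem u c⟩, ?_, ?_⟩
      · intro h
        have h1 := congrArg (fun q => (q.coeff 1).1) h
        simp [Polynomial.coeff_C] at h1
      · simp only [map_sub, map_mul, Polynomial.aeval_C, Polynomial.aeval_X]
        change AddMonoidAlgebra.single _ _ * _ - AddMonoidAlgebra.single _ _ = 0
        rw [AddMonoidAlgebra.single_mul_single, one_mul, sub_eq_zero]
        congr 1
        funext i
        simp only [Pi.add_apply, u, v, Finsupp.equivFunOnFinite_symm_apply_apply]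
        omega
  refine (Algebra.IsAlgebraic.trdeg_le_cardinalMk ℂ (Set.range x)).trans ?_
  simpa using Cardinal.mk_range_le (f := x)

/-- A faithful diagonal representation of a `k`-dimensional torus has `k` linearly independent
weights. -/
theorem exists_linearIndependent_weights {n k : ℕ} (a : Fin n → Fin k → ℤ)
    (ha : ∀ t : Fin k → ℂˣ, (∀ i, torusChar (a i) t = 1) → t = 1) :
    ∃ b : Fin k → Fin n, LinearIndependent ℤ (a ∘ b) := by
  let v : Fin n → Fin k → ℝ := fun i j => a i j
  have hspan : Submodule.span ℝ (Set.range v) = ⊤ := by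
    by_contra h
    obtain ⟨f, hf, hle⟩ := Submodule.exists_le_ker_of_lt_top _ (lt_top_iff_ne_top.2 h)
    -- If the weights did not span, some nonzero real c would be orthogonal to all of them, and
    -- exp(c) would be acted on trivially by every weight. Working over ℝ makes exp injective, so
    -- exp(c) = 1 forces c = 0.
    let c : Fin k → ℝ := fun j => f (Pi.single j 1)
    have hfc : ∀ x, f x = ∑ j, x j * c j := fun x => by
      rw [LinearMap.pi_apply_eq_sum_univ f x]
      refine Finset.sum_congr rfl fun i _ => ?_
      rw [smul_eq_mul]
      congr 2
      funext j
      simp [Pi.single_apply, eq_comm]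
    have h1 := ha (fun j => Units.mk0 (Complex.exp (c j)) (Complex.exp_ne_zero _)) fun i => by
      have h2 : f (v i) = 0 := hle (Submodule.subset_span ⟨i, rfl⟩)
      rw [hfc] at h2
      rw [torusChar_apply, Units.coe_prod]
      simp only [Units.val_zpow_eq_zpow_val, Units.val_mk0, ← Complex.exp_int_mul]
      rw [← Complex.exp_sum, ← Complex.exp_zero, ← Complex.ofReal_zero, ← h2]
      simp [v]
    refine hf (LinearMap.ext fun x => ?_)
    rw [hfc]
    refine Finset.sum_eq_zero fun j _ => ?_
    have h2 := congrArg Units.val (congrFun h1 j)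
    simp only [Units.val_mk0, Pi.one_apply, Units.val_one] at h2
    have h3 : Real.exp (c j) = 1 := by exact_mod_cast h2
    rw [(Real.exp_eq_one_iff _).1 h3, mul_zero]
  obtain ⟨κ, b, -, hb, hli⟩ := exists_linearIndependent' ℝ v
  let B := Module.Basis.mk hli (by rw [hb, hspan])
  let e := (Pi.basisFun ℝ (Fin k)).indexEquiv B
  refine ⟨b ∘ e, Fintype.linearIndependent_iff.2 fun g hg j => ?_⟩
  have h1 := Fintype.linearIndependent_iff.1 (hli.comp e e.injective) (fun j => g j) (by
    funext l
    have h2 := congrFun hg l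
    simp only [Finset.sum_apply, Pi.smul_apply, Function.comp_apply, smul_eq_mul,
      Pi.zero_apply, v] at h2 ⊢
    exact_mod_cast h2) j
  exact_mod_cast h1

theorem toricMap_X {n k : ℕ} (a : Fin n → Fin k → ℤ) (p : Fin n → ℂ) (i : Fin n) :
    toricMap a p (X i) = AddMonoidAlgebra.single (a i) (p i) :=
  aeval_X _ _

theorem algebraicIndependent_single {n k : ℕ} {a : Fin n → Fin k → ℤ}
    (ha : LinearIndependent ℤ a) {p : Fin n → ℂ} (hp : ∀ i, p i ≠ 0) :
    AlgebraicIndependent ℂ fun i => AddMonoidAlgebra.single (a i) (p i) :=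
  algebraicIndependent_iff_injective_aeval.2 (toricMap_injective ha hp)

/-- If the images of `x` under `f : A → B` form an algebraically independent family and `B` has
transcendence degree at most their number, then `x` gives a transcendence basis of `A ⧸ ker f`. -/
theorem AlgebraicIndependent.ringKrullDim_quotient_ker {F A B : Type} [Field F] [CommRing A]
    [CommRing B] [IsDomain B] [Algebra F A] [Algebra F B] [Algebra.FiniteType F A] (f : A →ₐ[F] B)
    {k : ℕ} {x : Fin k → A} (hx : AlgebraicIndependent F (f ∘ x)) (hB : Algebra.trdeg F B ≤ k) :
    ringKrullDim (A ⧸ RingHom.ker f) = k := by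
  have : (RingHom.ker f).IsPrime := RingHom.ker_isPrime _
  have hy : AlgebraicIndependent F fun j => Ideal.Quotient.mk (RingHom.ker f) (x j) :=
    AlgebraicIndependent.of_comp (Ideal.kerLiftAlg f) hx
  refine ringKrullDim_eq_of_isTranscendenceBasis
    (hy.isTranscendenceBasis_of_trdeg_le_of_finite ?_)
  rw [Cardinal.mk_fin]
  exact (_root_.trdeg_le_of_injective _ (Ideal.kerLiftAlg_injective f)).trans hB

theorem toricMap_comp_X {n k l : ℕ} (a : Fin n → Fin k → ℤ) (p : Fin n → ℂ) (b : Fin l → Fin n) :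
    toricMap a p ∘ (fun j => X (b j)) =
      fun j => AddMonoidAlgebra.single ((a ∘ b) j) ((p ∘ b) j) := by
  funext j
  exact toricMap_X a p (b j)

theorem algebraicIndependent_toricMap_comp_X {n k l : ℕ} (a : Fin n → Fin k → ℤ) (p : Fin n → ℂ)
    (hp : ∀ i, p i ≠ 0) (b : Fin l → Fin n) (hb : LinearIndependent ℤ (a ∘ b)) :
    AlgebraicIndependent ℂ (toricMap a p ∘ fun j => X (b j)) := by
  rw [toricMap_comp_X]
  exact algebraicIndependent_single hb (p := p ∘ b) fun j => hp _

theorem ringKrullDim_quotient_ker_toricMap {n k : ℕ} (a : Fin n → Fin k → ℤ) (p : Fin n → ℂ)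
    (hp : ∀ i, p i ≠ 0) (ha : ∀ t : Fin k → ℂˣ, (∀ i, torusChar (a i) t = 1) → t = 1) :
    ringKrullDim (MvPolynomial (Fin n) ℂ ⧸ RingHom.ker (toricMap a p)) = k := by
  obtain ⟨b, hb⟩ := exists_linearIndependent_weights a ha
  exact AlgebraicIndependent.ringKrullDim_quotient_ker (toricMap a p)
    (algebraicIndependent_toricMap_comp_X a p hp b hb) (trdeg_laurent_le k)

/-! ### Linear changes of coordinates -/

theorem linAct_linAct_inv {n : ℕ} (g : GL (Fin n) ℂ) (f : MvPolynomial (Fin n) ℂ) :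
    linAct g (linAct g⁻¹ f) = f := by
  rw [← AlgHom.comp_apply, ← linAct_mul, mul_inv_cancel, linAct_one, AlgHom.id_apply]

/-- The linear change of coordinates `f ↦ g.f` as an automorphism. -/
def linActEquiv {n : ℕ} (g : GL (Fin n) ℂ) :
    MvPolynomial (Fin n) ℂ ≃ₐ[ℂ] MvPolynomial (Fin n) ℂ :=
  AlgEquiv.ofAlgHom (linAct g) (linAct g⁻¹) (AlgHom.ext (linAct_linAct_inv g))
    (AlgHom.ext fun f => by simpa using linAct_linAct_inv g⁻¹ f)

theorem mem_coordChange {n : ℕ} {g : GL (Fin n) ℂ} {I : Ideal (MvPolynomial (Fin n) ℂ)}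
    {f : MvPolynomial (Fin n) ℂ} : f ∈ coordChange g I ↔ linAct g⁻¹ f ∈ I := by
  constructor
  · intro h
    have h1 : linAct g⁻¹ f ∈ coordChange g⁻¹ (coordChange g I) := Ideal.mem_map_of_mem _ h
    rwa [← coordChange_mul, inv_mul_cancel, coordChange_one] at h1
  · intro h
    rw [← linAct_linAct_inv g f]
    exact Ideal.mem_map_of_mem _ h

theorem isPrime_coordChange {n : ℕ} (g : GL (Fin n) ℂ) {I : Ideal (MvPolynomial (Fin n) ℂ)}
    (hI : I.IsPrime) : (coordChange g I).IsPrime := by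
  have : coordChange g I = I.comap (linAct g⁻¹) := by
    ext f
    exact mem_coordChange
  rw [this]
  exact Ideal.comap_isPrime _ _

theorem ringKrullDim_quotient_coordChange {n : ℕ} (g : GL (Fin n) ℂ)
    (I : Ideal (MvPolynomial (Fin n) ℂ)) :
    ringKrullDim (MvPolynomial (Fin n) ℂ ⧸ coordChange g I) =
      ringKrullDim (MvPolynomial (Fin n) ℂ ⧸ I) :=
  (ringKrullDim_eq_of_ringEquiv
    (Ideal.quotientEquiv I (coordChange g I) (linActEquiv g).toRingEquiv rfl)).symm

theorem mem_zeroLocus_iff_eval {n : ℕ} {I : Ideal (MvPolynomial (Fin n) ℂ)} {x : Fin n → ℂ} :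
    x ∈ zeroLocus ℂ I ↔ ∀ f ∈ I, eval x f = 0 := by
  rw [mem_zeroLocus_iff]
  simp only [aeval_eq_eval]

theorem mem_zeroLocus_coordChange {n : ℕ} {g : GL (Fin n) ℂ} {I : Ideal (MvPolynomial (Fin n) ℂ)}
    {x : Fin n → ℂ} :
    x ∈ zeroLocus ℂ (coordChange g I) ↔ (g⁻¹ : GL (Fin n) ℂ).val *ᵥ x ∈ zeroLocus ℂ I := by
  simp only [mem_zeroLocus_iff_eval]
  constructor
  · intro h f hf
    rw [← eval_linAct]
    exact h _ (Ideal.mem_map_of_mem _ hf)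
  · intro h f hf
    rw [← linAct_linAct_inv g f, eval_linAct]
    exact h _ (mem_coordChange.1 hf)

theorem mulVec_mem_zeroLocus_coordChange {n : ℕ} {g : GL (Fin n) ℂ}
    {I : Ideal (MvPolynomial (Fin n) ℂ)} {x : Fin n → ℂ} (hx : x ∈ zeroLocus ℂ I) :
    g.val *ᵥ x ∈ zeroLocus ℂ (coordChange g I) := by
  rw [mem_zeroLocus_coordChange, Matrix.mulVec_mulVec, ← Units.val_mul, inv_mul_cancel,
    Units.val_one, Matrix.one_mulVec]
  exact hx

theorem conj_mem_fixingGroup {n : ℕ} {I : Ideal (MvPolynomial (Fin n) ℂ)} (S : GL (Fin n) ℂ)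
    {g : GL (Fin n) ℂ} (hg : g ∈ fixingGroup I) :
    S * g * S⁻¹ ∈ fixingGroup (coordChange S I) := by
  change coordChange _ _ = _
  rw [← coordChange_mul, inv_mul_cancel_right, coordChange_mul]
  exact congrArg _ hg

theorem mulVec_mem_zeroLocus_of_mem_fixingGroup {n : ℕ} {I : Ideal (MvPolynomial (Fin n) ℂ)}
    {g : GL (Fin n) ℂ} (hg : g ∈ fixingGroup I) {x : Fin n → ℂ} (hx : x ∈ zeroLocus ℂ I) :
    g.val *ᵥ x ∈ zeroLocus ℂ I := by
  have h : coordChange g I = I := hg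
  rw [← h]
  exact mulVec_mem_zeroLocus_coordChange hx

theorem mem_of_forall_eval_eq_zero {n : ℕ} {J : Ideal (MvPolynomial (Fin n) ℂ)} (hJ : J.IsPrime)
    {f : MvPolynomial (Fin n) ℂ} (hf : ∀ x ∈ zeroLocus ℂ J, eval x f = 0) : f ∈ J := by
  rw [← MvPolynomial.IsPrime.vanishingIdeal_zeroLocus (K := ℂ) J, mem_vanishingIdeal_iff]
  exact hf

theorem varietyDim_zeroLocus {n : ℕ} {I : Ideal (MvPolynomial (Fin n) ℂ)} (hI : I.IsPrime) :
    varietyDim (zeroLocus ℂ I) = ringKrullDim (MvPolynomial (Fin n) ℂ ⧸ I) := by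
  rw [varietyDim, MvPolynomial.IsPrime.vanishingIdeal_zeroLocus]

/-- A prime ideal whose variety is nondegenerate contains no variable, in any coordinates. -/
theorem X_notMem_coordChange {n : ℕ} {I : Ideal (MvPolynomial (Fin n) ℂ)}
    (hI : IsNondegenerate (zeroLocus ℂ I)) (S : GL (Fin n) ℂ) (i : Fin n) :
    X i ∉ coordChange S I := by
  intro h
  -- The ith coordinate of Sx is the linear form given by row i of `S`, a nonzero row because `S` is
  -- invertible.
  refine hI (S.val i) (fun h0 => ?_) fun x hx => ?_
  · have h1 : (S.val * (S⁻¹ : GL (Fin n) ℂ).val) i i = 0 := by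
      rw [Matrix.mul_apply]
      simp [h0]
    rw [← Units.val_mul, mul_inv_cancel, Units.val_one, Matrix.one_apply_eq] at h1
    exact one_ne_zero h1
  · have := mem_zeroLocus_iff_eval.1 (mulVec_mem_zeroLocus_coordChange (g := S) hx) _ h
    rwa [eval_X] at this

/-! ### Torus points and orbit closures -/

/-- The points of the variety of `J` all of whose coordinates are nonzero. -/
def torusPoints {n : ℕ} (J : Ideal (MvPolynomial (Fin n) ℂ)) : Set (Fin n → ℂˣ) :=
  {q | (fun i => (q i : ℂ)) ∈ zeroLocus ℂ J}

/-- Multiplying f by x_1 ⋯ x_n makes it vanish off the torus as well, so the product lies in J by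
the Nullstellensatz; primality then removes the variables. -/
theorem mem_iff_forall_torusPoints {n : ℕ} {J : Ideal (MvPolynomial (Fin n) ℂ)} (hJ : J.IsPrime)
    (hX : ∀ i, X i ∉ J) {f : MvPolynomial (Fin n) ℂ} :
    f ∈ J ↔ ∀ q ∈ torusPoints J, eval (fun i => (q i : ℂ)) f = 0 := by
  refine ⟨fun h q hq => mem_zeroLocus_iff_eval.1 hq f h, fun h => ?_⟩
  have h1 : f * ∏ i, X i ∈ J := by
    refine mem_of_forall_eval_eq_zero hJ fun x hx => ?_
    rw [map_mul, map_prod]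
    simp only [eval_X]
    by_cases hx0 : ∀ i, x i ≠ 0
    · have h2 : eval x f = 0 := h (fun i => Units.mk0 (x i) (hx0 i)) hx
      rw [h2, zero_mul]
    · push Not at hx0
      obtain ⟨i, hi⟩ := hx0
      rw [Finset.prod_eq_zero (Finset.mem_univ i) hi, mul_zero]
  refine (hJ.mem_or_mem h1).resolve_right fun h2 => ?_
  obtain ⟨i, -, hi⟩ := (hJ.prod_mem_iff).1 h2
  exact hX i hi

theorem torusPoints_nonempty {n : ℕ} {J : Ideal (MvPolynomial (Fin n) ℂ)} (hJ : J.IsPrime)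
    (hX : ∀ i, X i ∉ J) : (torusPoints J).Nonempty := by
  by_contra h
  rw [Set.not_nonempty_iff_eq_empty] at h
  refine hJ.ne_top ((Ideal.eq_top_iff_one _).2 ((mem_iff_forall_torusPoints hJ hX).2 ?_))
  simp [h]

/-- An element of K outside J is a nonzerodivisor of the domain A/J, and killing it lowers the
finite dimension by at least one. -/
theorem eq_of_le_of_ringKrullDim_eq {A : Type*} [CommRing A] {J K : Ideal A} (hJ : J.IsPrime)
    (hJK : J ≤ K) {k : ℕ} (h1 : ringKrullDim (A ⧸ J) = k) (h2 : ringKrullDim (A ⧸ K) = k) :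
    J = K := by
  refine le_antisymm hJK fun f hf => ?_
  by_contra hfJ
  have h3 := ringKrullDim_succ_le_of_surjective (Ideal.Quotient.factor hJK)
    (Ideal.Quotient.factor_surjective hJK) (r := Ideal.Quotient.mk J f)
    (mem_nonZeroDivisors_of_ne_zero fun h => hfJ (Ideal.Quotient.eq_zero_iff_mem.1 h))
    (by rw [Ideal.Quotient.factor_mk]; exact Ideal.Quotient.eq_zero_iff_mem.2 hf)
  rw [h1, h2] at h3
  have h4 : k + 1 ≤ k := by exact_mod_cast h3
  omega

/-- If a diagonal torus stabilizes the variety of `J`, then `J` vanishes on its orbits. -/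
theorem coordChange_le_ker_toricMap {n k : ℕ} {I : Ideal (MvPolynomial (Fin n) ℂ)}
    {S : GL (Fin n) ℂ} {φ : (Fin k → ℂˣ) →* GL (Fin n) ℂ} (hφ : φ.range ≤ fixingGroup I)
    {a : Fin n → Fin k → ℤ} (ha : ∀ t, S.val * (φ t).val * (S⁻¹ : GL (Fin n) ℂ).val =
      diagonal fun i => torusChar (a i) t)
    {p : Fin n → ℂ} (hp : p ∈ zeroLocus ℂ (coordChange S I)) :
    coordChange S I ≤ RingHom.ker (toricMap a p) := by
  intro f hf
  refine mem_ker_toricMap.2 fun t => ?_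
  have h := mulVec_mem_zeroLocus_of_mem_fixingGroup
    (conj_mem_fixingGroup S (hφ ⟨t, rfl⟩)) hp
  rw [Units.val_mul, Units.val_mul, ha] at h
  have h2 := mem_zeroLocus_iff_eval.1 h f hf
  convert h2 using 3
  funext i
  rw [Matrix.mulVec_diagonal, mul_comm]

theorem eq_one_of_torusChar_eq_one {n k : ℕ} {S : GL (Fin n) ℂ}
    {φ : (Fin k → ℂˣ) →* GL (Fin n) ℂ} (hφ : Function.Injective φ)
    {a : Fin n → Fin k → ℤ} (ha : ∀ t, S.val * (φ t).val * (S⁻¹ : GL (Fin n) ℂ).val =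
      diagonal fun i => torusChar (a i) t) (t : Fin k → ℂˣ) (ht : ∀ i, torusChar (a i) t = 1) :
    t = 1 := by
  have h1 : S * φ t * S⁻¹ = 1 := by
    ext1
    rw [Units.val_mul, Units.val_mul, ha]
    simp [ht]
  refine hφ ?_
  rw [map_one]
  calc φ t = S⁻¹ * (S * φ t * S⁻¹) * S := by group
    _ = 1 := by rw [h1]; group

/-- The orbit of p lies in the variety and already has its full dimension, so its closure is the
whole irreducible variety. -/
theorem coordChange_eq_ker_toricMap {n k : ℕ} {I : Ideal (MvPolynomial (Fin n) ℂ)}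
    (hI : I.IsPrime) (hdim : varietyDim (zeroLocus ℂ I) = k)
    {S : GL (Fin n) ℂ} {φ : (Fin k → ℂˣ) →* GL (Fin n) ℂ} (hφ : φ.range ≤ fixingGroup I)
    (hinj : Function.Injective φ)
    {a : Fin n → Fin k → ℤ} (ha : ∀ t, S.val * (φ t).val * (S⁻¹ : GL (Fin n) ℂ).val =
      diagonal fun i => torusChar (a i) t)
    {p : Fin n → ℂ} (hp : p ∈ zeroLocus ℂ (coordChange S I)) (hp0 : ∀ i, p i ≠ 0) :
    coordChange S I = RingHom.ker (toricMap a p) := by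
  refine eq_of_le_of_ringKrullDim_eq (isPrime_coordChange S hI)
    (coordChange_le_ker_toricMap hφ ha hp) (k := k) ?_
    (ringKrullDim_quotient_ker_toricMap a p hp0 (eq_one_of_torusChar_eq_one hinj ha))
  rw [ringKrullDim_quotient_coordChange, ← varietyDim_zeroLocus hI, hdim]

/-- The diagonal torus. -/
def diagGL (n : ℕ) : (Fin n → ℂˣ) →* GL (Fin n) ℂ where
  toFun t := ⟨diagonal fun i => (t i : ℂ), diagonal fun i => ((t i)⁻¹ : ℂˣ),
    by simp [Matrix.diagonal_mul_diagonal], by simp [Matrix.diagonal_mul_diagonal]⟩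
  map_one' := by
    ext1
    simp
  map_mul' s t := by
    ext1
    simp [Matrix.diagonal_mul_diagonal]

theorem diagGL_val {n : ℕ} (t : Fin n → ℂˣ) : (diagGL n t).val = diagonal fun i => (t i : ℂ) := rfl

theorem diagGL_mulVec {n : ℕ} (t q : Fin n → ℂˣ) :
    (diagGL n t).val *ᵥ (fun i => (q i : ℂ)) = fun i => ((t * q) i : ℂ) := by
  funext i
  rw [diagGL_val, Matrix.mulVec_diagonal]
  rfl

/-- If the dimension of the variety is that of a torus acting on it, the ideal is toric in suitable
coordinates. -/
theorem exists_isToricIdeal_coordChange {n k : ℕ} {I : Ideal (MvPolynomial (Fin n) ℂ)}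
    (hI : I.IsPrime) (hnd : IsNondegenerate (zeroLocus ℂ I))
    (hdim : varietyDim (zeroLocus ℂ I) = k)
    {φ : (Fin k → ℂˣ) →* GL (Fin n) ℂ} (hφ : φ.range ≤ fixingGroup I)
    (hinj : Function.Injective φ) (hreg : ∀ i j, IsRegularOnTorus fun t => (φ t).val i j) :
    ∃ S : GL (Fin n) ℂ, IsToricIdeal (coordChange S I) := by
  obtain ⟨S, a, ha⟩ := exists_diagonal_torusChar φ hreg
  obtain ⟨q, hq⟩ := torusPoints_nonempty (isPrime_coordChange S hI) (X_notMem_coordChange hnd S)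
  -- Rescaling moves the torus point q to (1, …, 1), making the binomials unital; diagonal matrices
  -- commute, so the weights are unchanged.
  refine ⟨diagGL n q⁻¹ * S, ?_⟩
  have hp : (1 : Fin n → ℂ) ∈ zeroLocus ℂ (coordChange (diagGL n q⁻¹ * S) I) := by
    have h := mulVec_mem_zeroLocus_coordChange (g := diagGL n q⁻¹) hq
    rw [diagGL_mulVec, inv_mul_cancel, ← coordChange_mul] at h
    exact h
  have ha' : ∀ t, (diagGL n q⁻¹ * S).val * (φ t).val * ((diagGL n q⁻¹ * S)⁻¹ : GL (Fin n) ℂ).val =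
      diagonal fun i => torusChar (a i) t := by
    intro t
    have h : ((diagGL n q⁻¹ * S) * φ t * (diagGL n q⁻¹ * S)⁻¹).val =
        (diagGL n q⁻¹).val * (S * φ t * S⁻¹).val * ((diagGL n q⁻¹)⁻¹ : GL (Fin n) ℂ).val := by
      rw [← Units.val_mul, ← Units.val_mul]
      congr 1
      group
    rw [← Units.val_mul, ← Units.val_mul, h, Units.val_mul, Units.val_mul, ha, ← map_inv,
      diagGL_val, diagGL_val, Matrix.diagonal_mul_diagonal, Matrix.diagonal_mul_diagonal]
    congr 1
    funext i
    simp [mul_right_comm]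
  rw [coordChange_eq_ker_toricMap hI hdim hφ hinj ha' hp fun _ => one_ne_zero]
  exact isToricIdeal_ker_toricMap_one a

/-! ### Saturated lattices and subtori -/

/-- The pairing `u ↦ t_1^{u_1} ⋯ t_n^{u_n}` of the character lattice with a point of the torus. -/
def torusPairing {n : ℕ} (t : Fin n → ℂˣ) : (Fin n → ℤ) →ₗ[ℤ] Additive ℂˣ :=
  (Pi.basisFun ℤ (Fin n)).constr ℤ fun i => Additive.ofMul (t i)

theorem torusPairing_single {n : ℕ} (t : Fin n → ℂˣ) (i : Fin n) :
    torusPairing t (Pi.single i 1) = Additive.ofMul (t i) := by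
  rw [← Pi.basisFun_apply, torusPairing, Module.Basis.constr_basis]

theorem toMul_torusPairing {n : ℕ} (t : Fin n → ℂˣ) (u : Fin n → ℤ) :
    (torusPairing t u).toMul = ∏ i, t i ^ u i := by
  rw [torusPairing, Module.Basis.constr_apply_fintype, toMul_sum]
  rfl

theorem torusPairing_ext {n : ℕ} {t : Fin n → ℂˣ} {f : (Fin n → ℤ) →ₗ[ℤ] Additive ℂˣ}
    (h : ∀ i, f (Pi.single i 1) = Additive.ofMul (t i)) : torusPairing t = f :=
  (Pi.basisFun ℤ (Fin n)).ext fun i => by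
    rw [Pi.basisFun_apply, torusPairing_single, h]

theorem torusPairing_inv {n : ℕ} (t : Fin n → ℂˣ) : torusPairing t⁻¹ = -torusPairing t :=
  torusPairing_ext fun i => by
    rw [LinearMap.neg_apply, torusPairing_single]
    rfl

/-- A saturated sublattice of `ℤ^n` cuts out a subtorus of `(ℂ^*)^n`. -/
theorem exists_subtorus {n : ℕ} (L : Submodule ℤ (Fin n → ℤ))
    (hL : ∀ m : ℕ, m ≠ 0 → ∀ w, m • w ∈ L → w ∈ L) :
    ∃ (m : ℕ) (χ : (Fin m → ℂˣ) →* (Fin n → ℂˣ)) (a : Fin n → Fin m → ℤ),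
      Function.Injective χ ∧ (∀ s i, ((χ s i : ℂˣ) : ℂ) = torusChar (a i) s) ∧
      ∀ t, t ∈ χ.range ↔ L ≤ (torusPairing t).ker := by
  -- Saturation makes ℤ^n/L torsion-free, hence free. The points killed by L are the homomorphisms
  -- ℤ^n/L → ℂˣ, and a basis identifies these with a torus.
  have : Module.IsTorsionFree ℤ ((Fin n → ℤ) ⧸ L) := by
    refine .of_smul_eq_zero fun r x hx => or_iff_not_imp_left.2 fun hr => ?_
    obtain ⟨w, rfl⟩ := L.mkQ_surjective x
    rw [← map_smul, Submodule.mkQ_apply, Submodule.Quotient.mk_eq_zero] at hx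
    rw [Submodule.mkQ_apply, Submodule.Quotient.mk_eq_zero]
    refine hL r.natAbs (Int.natAbs_ne_zero.2 hr) w ?_
    rw [← natCast_zsmul]
    rcases Int.natAbs_eq r with h | h
    · rwa [← h]
    · rw [h, neg_smul] at hx
      exact L.neg_mem_iff.1 hx
  let B := Module.finBasis ℤ ((Fin n → ℤ) ⧸ L)
  let e : Fin n → (Fin n → ℤ) ⧸ L := fun i => L.mkQ (Pi.single i 1)
  let ev : (Fin (Module.finrank ℤ ((Fin n → ℤ) ⧸ L)) → ℂˣ) →
      ((Fin n → ℤ) ⧸ L) →ₗ[ℤ] Additive ℂˣ := fun s => B.constr ℤ fun j => Additive.ofMul (s j)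
  have hev : ∀ s j, ev s (B j) = Additive.ofMul (s j) := fun s j => B.constr_basis ℤ _ j
  have hev' : ∀ s x, (ev s x).toMul = ∏ j, s j ^ B.repr x j := fun s x => by
    simp only [ev]
    rw [Module.Basis.constr_apply_fintype, toMul_sum]
    rfl
  let χ : (Fin (Module.finrank ℤ ((Fin n → ℤ) ⧸ L)) → ℂˣ) →* (Fin n → ℂˣ) :=
    { toFun := fun s i => (ev s (e i)).toMul
      map_one' := by
        funext i
        simp [hev']
      map_mul' := fun s s' => by
        funext i
        simp [hev', mul_zpow, Finset.prod_mul_distrib] }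
  have hχ : ∀ s, torusPairing (χ s) = ev s ∘ₗ L.mkQ := fun s => torusPairing_ext fun i => rfl
  refine ⟨_, χ, fun i j => B.repr (e i) j, fun s s' h => ?_, fun s i => ?_, fun t => ⟨?_, fun h => ?_⟩⟩
  · have h1 : ev s ∘ₗ L.mkQ = ev s' ∘ₗ L.mkQ := by rw [← hχ, ← hχ, h]
    have h2 : ev s = ev s' := (LinearMap.cancel_right L.mkQ_surjective).1 h1
    funext j
    exact Additive.ofMul.injective (by rw [← hev, ← hev, h2])
  · rw [torusChar_apply]
    exact congrArg Units.val (hev' s (e i))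
  · rintro ⟨s, rfl⟩ w hw
    rw [hχ, LinearMap.mem_ker, LinearMap.comp_apply, Submodule.mkQ_apply,
      (Submodule.Quotient.mk_eq_zero L).2 hw, map_zero]
  · refine ⟨fun j => (L.liftQ (torusPairing t) h (B j)).toMul, ?_⟩
    have h1 : ev (fun j => (L.liftQ (torusPairing t) h (B j)).toMul) =
        L.liftQ (torusPairing t) h := B.ext fun j => hev _ j
    funext i
    change (ev _ (e i)).toMul = _
    rw [h1]
    simp only [e, Submodule.mkQ_apply, Submodule.liftQ_apply, torusPairing_single]
    rfl

theorem eval_monomial_eq_torusPairing {n : ℕ} (t : Fin n → ℂˣ) (u : Fin n →₀ ℕ) (c : ℂ) :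
    eval (fun i => (t i : ℂ)) (monomial u c) =
      c * ((torusPairing t fun i => (u i : ℤ)).toMul : ℂˣ) := by
  rw [eval_monomial, Finsupp.prod_fintype _ _ (fun i => pow_zero _), toMul_torusPairing]
  simp

theorem torusPairing_mul {n : ℕ} (s t : Fin n → ℂˣ) :
    torusPairing (s * t) = torusPairing s + torusPairing t :=
  torusPairing_ext fun i => by
    rw [LinearMap.add_apply, torusPairing_single, torusPairing_single]
    rfl

theorem torusPairing_div {n : ℕ} (s t : Fin n → ℂˣ) :
    torusPairing (s / t) = torusPairing s - torusPairing t := by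
  rw [div_eq_mul_inv, torusPairing_mul, torusPairing_inv, sub_eq_add_neg]

/-! ### Binomial ideals and maximality of the torus -/

/-- The lattice of Laurent monomials that are constant on the torus points of `J`. -/
def constLattice {n : ℕ} (J : Ideal (MvPolynomial (Fin n) ℂ)) (p : Fin n → ℂˣ) :
    Submodule ℤ (Fin n → ℤ) :=
  ⨅ q ∈ torusPoints J, (torusPairing (q / p)).ker

theorem mem_constLattice {n : ℕ} {J : Ideal (MvPolynomial (Fin n) ℂ)} {p : Fin n → ℂˣ}
    {w : Fin n → ℤ} :
    w ∈ constLattice J p ↔ ∀ q ∈ torusPoints J, torusPairing q w = torusPairing p w := by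
  simp only [constLattice, Submodule.mem_iInf, LinearMap.mem_ker, torusPairing_div,
    LinearMap.sub_apply, sub_eq_zero]

theorem constLattice_le_ker {n : ℕ} {J : Ideal (MvPolynomial (Fin n) ℂ)} {p q : Fin n → ℂˣ}
    (hq : q ∈ torusPoints J) : constLattice J p ≤ (torusPairing (q / p)).ker :=
  iInf₂_le q hq

/-- Write w = u - v, P = p^v x^u and Q = p^u x^v. If mw is in the lattice, then P^m - Q^m lies in J.
It factors into the P - ζQ over the mth roots of unity, so primality puts one factor in J, and
evaluation at p forces ζ = 1. -/
theorem constLattice_saturated {n : ℕ} {J : Ideal (MvPolynomial (Fin n) ℂ)} (hJ : J.IsPrime)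
    (hX : ∀ i, X i ∉ J) {p : Fin n → ℂˣ} (hp : p ∈ torusPoints J) (m : ℕ) (hm : m ≠ 0)
    (w : Fin n → ℤ) (hw : m • w ∈ constLattice J p) : w ∈ constLattice J p := by
  let u : Fin n →₀ ℕ := Finsupp.equivFunOnFinite.symm fun i => (w i).toNat
  let v : Fin n →₀ ℕ := Finsupp.equivFunOnFinite.symm fun i => (-w i).toNat
  have huv : w = (fun i => (u i : ℤ)) - fun i => (v i : ℤ) := by
    funext i
    simp only [Pi.sub_apply, u, v, Finsupp.equivFunOnFinite_symm_apply_apply]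
    omega
  let g : (Fin n → ℂˣ) → (Fin n →₀ ℕ) → ℂˣ := fun q u => (torusPairing q fun i => (u i : ℤ)).toMul
  have hg : ∀ q, (torusPairing q w).toMul = g q u / g q v := fun q => by
    rw [huv, map_sub]
    rfl
  let P : MvPolynomial (Fin n) ℂ := monomial u (g p v)
  let Q : MvPolynomial (Fin n) ℂ := monomial v (g p u)
  have hPQ : ∀ q : Fin n → ℂˣ, eval (fun i => (q i : ℂ)) P = ((g p v * g q u : ℂˣ) : ℂ) ∧
      eval (fun i => (q i : ℂ)) Q = ((g p u * g q v : ℂˣ) : ℂ) := fun q => by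
    simp only [P, Q, eval_monomial_eq_torusPairing]
    exact ⟨rfl, rfl⟩
  have hpow : P ^ m - Q ^ m ∈ J := by
    refine (mem_iff_forall_torusPoints hJ hX).2 fun q hq => ?_
    have h1 := congrArg Additive.toMul (mem_constLattice.1 hw q hq)
    rw [map_nsmul (torusPairing q), map_nsmul (torusPairing p), toMul_nsmul, toMul_nsmul, hg, hg, div_pow, div_pow,
      div_eq_div_iff_mul_eq_mul, ← mul_pow, ← mul_pow] at h1
    rw [map_sub, map_pow, map_pow, (hPQ q).1, (hPQ q).2, ← Units.val_pow_eq_pow_val,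
      ← Units.val_pow_eq_pow_val, mul_comm (g p v), h1, sub_self]
  have hroot : IsPrimitiveRoot (C (σ := Fin n) (Complex.exp (2 * Real.pi * Complex.I / m))) m :=
    (Complex.isPrimitiveRoot_exp m hm).map_of_injective (C_injective (Fin n) ℂ)
  rw [hroot.pow_sub_pow_eq_prod_sub_mul P Q (Nat.pos_of_ne_zero hm)] at hpow
  obtain ⟨ζ, hζ, hmem⟩ := hJ.prod_mem_iff.1 hpow
  have hζm : ζ ^ m = 1 := (Polynomial.mem_nthRootsFinset (Nat.pos_of_ne_zero hm) 1).1 hζ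
  -- The root of unity ζ is a priori a polynomial; being a unit, it is a constant.
  have hunit : IsUnit ζ := IsUnit.of_pow_eq_one hζm hm
  have hC := totalDegree_eq_zero_iff_eq_C.1 (isUnit_iff_totalDegree_of_isReduced.1 hunit).2
  have h1 := (mem_iff_forall_torusPoints hJ hX).1 hmem p hp
  rw [hC] at h1
  simp only [map_sub, map_mul, eval_C, (hPQ p).1, (hPQ p).2] at h1
  have hc : coeff 0 ζ = 1 := by
    rw [mul_comm (g p u), ← one_sub_mul] at h1
    exact (sub_eq_zero.1 ((mul_eq_zero.1 h1).resolve_right (Units.ne_zero _))).symm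
  rw [hC, hc, C_1, one_mul] at hmem
  refine mem_constLattice.2 fun q hq => ?_
  have h2 := (mem_iff_forall_torusPoints hJ hX).1 hmem q hq
  rw [map_sub, (hPQ q).1, (hPQ q).2, sub_eq_zero, Units.val_inj] at h2
  refine Additive.toMul.injective ?_
  rw [hg, hg, div_eq_div_iff_mul_eq_mul, mul_comm (g q u), h2]

/-- The torus points of the variety of a binomial ideal form a coset of the subtorus cut out by the
lattice of constant Laurent monomials. -/
theorem IsBinomialIdeal.mul_mem_torusPoints {n : ℕ} {J : Ideal (MvPolynomial (Fin n) ℂ)}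
    (hJ : IsBinomialIdeal J) {p : Fin n → ℂˣ} (hp : p ∈ torusPoints J) {t : Fin n → ℂˣ}
    (ht : constLattice J p ≤ (torusPairing t).ker) : t * p ∈ torusPoints J := by
  obtain ⟨B, hB, rfl⟩ := hJ
  have key : ∀ f ∈ B, eval (fun i => ((t * p) i : ℂ)) f = 0 := by
    intro f hf
    obtain ⟨a, b, c, rfl⟩ := hB f hf
    have h1 : ∀ q ∈ torusPoints (Ideal.span B),
        (((torusPairing q fun i => (a i : ℤ)).toMul : ℂˣ) : ℂ) =
          c * ((torusPairing q fun i => (b i : ℤ)).toMul : ℂˣ) := by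
      intro q hq
      have := mem_zeroLocus_iff_eval.1 hq _ (Ideal.subset_span hf)
      rwa [map_sub, eval_monomial_eq_torusPairing, eval_monomial_eq_torusPairing, one_mul,
        sub_eq_zero] at this
    -- A generator x^a - c x^b makes x^{a-b} equal to c at every torus point, so a - b is in the
    -- lattice and t scales both terms equally.
    have hw : ((fun i => (a i : ℤ)) - fun i => (b i : ℤ)) ∈ constLattice (Ideal.span B) p := by
      refine mem_constLattice.2 fun q hq => Additive.toMul.injective ?_
      rw [map_sub (torusPairing q), map_sub (torusPairing p), toMul_sub, toMul_sub]
      ext1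
      rw [Units.val_div_eq_div_val, Units.val_div_eq_div_val, h1 q hq, h1 p hp,
        mul_div_cancel_right₀ _ (Units.ne_zero _), mul_div_cancel_right₀ _ (Units.ne_zero _)]
    have h2 := ht hw
    rw [LinearMap.mem_ker, map_sub, sub_eq_zero] at h2
    rw [map_sub, eval_monomial_eq_torusPairing, eval_monomial_eq_torusPairing, torusPairing_mul,
      LinearMap.add_apply, LinearMap.add_apply, toMul_add, toMul_add, Units.val_mul, Units.val_mul,
      h1 p hp, h2]
    ring
  refine mem_zeroLocus_iff_eval.2 fun f hf => ?_
  exact (Ideal.span_le (I := RingHom.ker (eval fun i => ((t * p) i : ℂ)))).2 key hf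

/-- J is determined by its torus points, so permuting them suffices; t⁻¹ is needed to get equality
of ideals and not just an inclusion. -/
theorem diagGL_mem_fixingGroup {n : ℕ} {J : Ideal (MvPolynomial (Fin n) ℂ)} (hJ : J.IsPrime)
    (hX : ∀ i, X i ∉ J) {t : Fin n → ℂˣ} (h1 : ∀ q ∈ torusPoints J, t * q ∈ torusPoints J)
    (h2 : ∀ q ∈ torusPoints J, t⁻¹ * q ∈ torusPoints J) : diagGL n t ∈ fixingGroup J := by
  change coordChange _ J = J
  ext f
  rw [mem_coordChange, mem_iff_forall_torusPoints hJ hX, mem_iff_forall_torusPoints hJ hX]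
  have h3 : ∀ q : Fin n → ℂˣ, eval (fun i => (q i : ℂ)) (linAct (diagGL n t)⁻¹ f) =
      eval (fun i => ((t * q) i : ℂ)) f := fun q => by
    rw [eval_linAct, inv_inv, diagGL_mulVec]
  constructor
  · intro h q hq
    have := h _ (h2 q hq)
    rwa [h3, mul_inv_cancel_left] at this
  · intro h q hq
    rw [h3]
    exact h _ (h1 q hq)

/-- If `I` becomes binomial in coordinates diagonalizing a maximal torus of its fixing group, then
this torus has an open orbit in the variety of `I`. -/
theorem IsBinomialIdeal.varietyDim_eq {n k : ℕ} {I : Ideal (MvPolynomial (Fin n) ℂ)}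
    (hI : I.IsPrime) (hnd : IsNondegenerate (zeroLocus ℂ I)) {S : GL (Fin n) ℂ}
    (hS : IsBinomialIdeal (coordChange S I))
    {φ : (Fin k → ℂˣ) →* GL (Fin n) ℂ} (hT : IsMaximalTorus (fixingGroup I) φ.range)
    (hinj : Function.Injective φ)
    {a : Fin n → Fin k → ℤ} (ha : ∀ t, S.val * (φ t).val * (S⁻¹ : GL (Fin n) ℂ).val =
      diagonal fun i => torusChar (a i) t) :
    varietyDim (zeroLocus ℂ I) = k := by
  have hJ := isPrime_coordChange S hI
  have hX := X_notMem_coordChange hnd S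
  obtain ⟨p, hp⟩ := torusPoints_nonempty hJ hX
  obtain ⟨m, χ, b, hχinj, hχreg, hχ⟩ := exists_subtorus (constLattice (coordChange S I) p)
    (constLattice_saturated hJ hX hp)
  -- The base point may be changed from p to q, since q/p itself satisfies the lattice equations.
  have hsub : ∀ t, constLattice (coordChange S I) p ≤ (torusPairing t).ker →
      ∀ q ∈ torusPoints (coordChange S I), t * q ∈ torusPoints (coordChange S I) := by
    intro t ht q hq
    have h1 := hS.mul_mem_torusPoints hp (t := t * (q / p)) fun w hw => by
      have h2 := ht hw
      have h3 := constLattice_le_ker hq hw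
      rw [LinearMap.mem_ker] at h2 h3 ⊢
      rw [torusPairing_mul, LinearMap.add_apply, h2, h3, add_zero]
    rwa [mul_assoc, div_mul_cancel] at h1
  let ψ : (Fin m → ℂˣ) →* GL (Fin n) ℂ :=
    (MulAut.conj S⁻¹).toMonoidHom.comp ((diagGL n).comp χ)
  have hψ : ∀ s, ψ s = S⁻¹ * diagGL n (χ s) * S := fun s => by simp [ψ]
  have hdiag : Function.Injective (diagGL n) := fun s t h => by
    funext i
    have := congrArg (fun g : GL (Fin n) ℂ => g.val i i) h
    exact Units.ext (by simpa [diagGL_val] using this)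
  have hψfix : ψ.range ≤ fixingGroup I := by
    rintro _ ⟨s, rfl⟩
    have ht := (hχ (χ s)).1 ⟨s, rfl⟩
    have h1 := diagGL_mem_fixingGroup hJ hX (hsub _ ht) (hsub _ (by
      rw [← map_inv]
      exact (hχ (χ s⁻¹)).1 ⟨_, rfl⟩))
    have h2 := conj_mem_fixingGroup S⁻¹ h1
    rw [← coordChange_mul, inv_mul_cancel, coordChange_one, inv_inv, ← hψ] at h2
    exact h2
  have hψtorus : IsTorusOfDim ψ.range m := by
    refine ⟨ψ, (MulAut.conj S⁻¹).injective.comp (hdiag.comp hχinj), fun i j => ?_, rfl⟩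
    have := isRegularOnTorus_mul_mul (fun s => (diagGL n (χ s)).val) (fun i j => ?_)
      (S⁻¹ : GL (Fin n) ℂ).val S.val i j
    · convert this using 2 with s
      rw [hψ, Units.val_mul, Units.val_mul]
    · have := isRegularOnTorus_sum_torusChar Finset.univ
        (fun _ : Unit => if i = j then (1 : ℂ) else 0) fun _ => b i
      convert this using 2 with s
      rw [diagGL_val, Matrix.diagonal_apply, hχreg]
      simp
  have hφfix := hT.prop.1
  -- An element d of the diagonalized torus sends p to another torus point dp, so constancy of the
  -- lattice monomials makes them trivial on d.
  have hle : φ.range ≤ ψ.range := by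
    rintro _ ⟨t, rfl⟩
    let d : Fin n → ℂˣ := fun i => Units.mk0 (torusChar (a i) t) (torusChar_ne_zero _ _)
    have hd : S * φ t * S⁻¹ = diagGL n d := by
      ext1
      rw [Units.val_mul, Units.val_mul, ha]
      rfl
    have h1 := mulVec_mem_zeroLocus_of_mem_fixingGroup
      (conj_mem_fixingGroup S (hφfix ⟨t, rfl⟩)) hp
    rw [hd, diagGL_mulVec] at h1
    have h2 := constLattice_le_ker (p := p) (q := d * p) h1
    rw [mul_div_cancel_right] at h2
    obtain ⟨s, hs⟩ := (hχ d).2 h2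
    refine ⟨s, ?_⟩
    rw [hψ, hs, ← hd]
    group
  have hge : ψ.range ≤ φ.range := hT.le_of_ge ⟨hψfix, m, hψtorus⟩ hle
  -- By maximality the two tori agree, so every torus point q is a translate of p under T, and a
  -- polynomial vanishing on the orbit of p vanishes at all torus points.
  have hker : coordChange S I = RingHom.ker (toricMap a fun i => (p i : ℂ)) := by
    refine le_antisymm (coordChange_le_ker_toricMap hφfix ha hp) fun f hf => ?_
    refine (mem_iff_forall_torusPoints hJ hX).2 fun q hq => ?_
    obtain ⟨s, hs⟩ := (hχ (q / p)).2 (constLattice_le_ker hq)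
    obtain ⟨t, ht⟩ := hge ⟨s, rfl⟩
    have h1 : S * φ t * S⁻¹ = diagGL n (q / p) := by
      rw [ht, hψ, hs]
      group
    have h2 : diagonal (fun i => torusChar (a i) t) = diagonal fun i => ((q / p) i : ℂ) := by
      rw [← ha, ← diagGL_val, ← h1, Units.val_mul, Units.val_mul]
    have h3 := mem_ker_toricMap.1 hf t
    convert h3 using 3
    funext i
    have h4 := congrFun (Matrix.diagonal_injective h2) i
    rw [h4, ← Units.val_mul, Pi.div_apply, mul_div_cancel]
  rw [varietyDim_zeroLocus hI, ← ringKrullDim_quotient_coordChange S, hker]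
  exact ringKrullDim_quotient_ker_toricMap a _ (fun i => (p i).ne_zero)
    (eq_one_of_torusChar_eq_one hinj ha)

end

/-! ### The main theorem -/

theorem mainTheorem2 (n : ℕ) (I : Ideal (MvPolynomial (Fin n) ℂ))
    (hprime : I.IsPrime)
    (hhom : I.IsHomogeneous (MvPolynomial.homogeneousSubmodule (Fin n) ℂ))
    (hnondeg : IsNondegenerate (MvPolynomial.zeroLocus ℂ I))
    (T : Subgroup (GL (Fin n) ℂ)) (hT : IsMaximalTorus (fixingGroup I) T)
    (k : ℕ) (hk : IsTorusOfDim T k) :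
    (varietyDim (MvPolynomial.zeroLocus ℂ I) = k →
      ∃ S : GL (Fin n) ℂ, IsToricIdeal (coordChange S I)) ∧
    (∀ S : GL (Fin n) ℂ, Diagonalizes S (lieAlgebraOf T) →
      (IsBinomialIdeal (coordChange S I) ↔
        varietyDim (MvPolynomial.zeroLocus ℂ I) = k)) := by
  obtain ⟨φ, hinj, hreg, rfl⟩ := hk
  have hfix := hT.prop.1
  refine ⟨fun hdim => exists_isToricIdeal_coordChange hprime hnondeg hdim hfix hinj hreg,
    fun S hS => ?_⟩
  obtain ⟨a, ha⟩ := exists_eq_diagonal_torusChar S φ hreg (hS.isDiag_conj φ hreg le_rfl)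
  refine ⟨fun h => h.varietyDim_eq hprime hnondeg hT hinj ha, fun hdim => ?_⟩
  obtain ⟨p, hp⟩ := torusPoints_nonempty (isPrime_coordChange S hprime)
    (X_notMem_coordChange hnondeg S)
  rw [coordChange_eq_ker_toricMap hprime hdim hfix hinj ha hp fun i => (p i).ne_zero]
  exact isBinomialIdeal_ker_toricMap a _ fun i => (p i).ne_zero
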